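/- **Setting.** A project is a pair $a=(F,c)$ of a probability distribution $F$ on $\mathbb{R}_+$ with finite expectation and a cost $c\ge 0$. A contract is a measurable function $w:\mathbb{R}_+\to\mathbb{R}_+$. The agent has a finite collection of projects $\mathcal{A}$, each of which he may sample any number of times; every draw from $a_i=(F_i,c_i)$ costs him $c_i$ and yields a prize distributed according to $F_i$, independently of all other draws. A strategy prescribes, as a measurable function of the prizes drawn so far, either the project to sample next or to stop, and in the latter case which prize $y$ to present: one of the drawn prizes or the prize $0$. Only strategies that stop almost surely are admitted. The agent's payoff from a strategy $\sigma$ is $U_\sigma=\mathbb{E}_\sigma[w(y)]-\mathbb{E}_\sigma[\text{total search cost}]\in[-\infty,\infty]$, which is set to $-\infty$ if the expected search cost is infinite; the principal's payoff is $\pi_\sigma=\mathbb{E}_\sigma[y-w(y)]\in[-\infty,\infty]$, which is set to $-\infty$ if the positive and the negative part of $y-w(y)$ both have infinite expectation. Let $U^*=\sup_\sigma U_\sigma$ and let $\Sigma(w,\mathcal{A})$ be the set of strategies that maximize $U_\sigma$. Put $V_P(w\mid\mathcal{A})=\sup_{\sigma\in\Sigma(w,\mathcal{A})}\pi_\sigma$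 if $\Sigma(w,\mathcal{A})\neq\emptyset$, and $V_P(w\mid\mathcal{A})=\inf_{v<U^*}\sup_{\sigma:\,U_\sigma>v}\pi_\sigma$ otherwise. The principal knows only one project $a_0=(F_0,c_0)$; the payoff guarantee of $w$ is $V_P(w)=\inf_{\mathcal{A}\ni a_0}V_P(w\mid\mathcal{A})$, the infimum being over all finite collections containing $a_0$, and $w$ is robustly optimal if $V_P(w)=\sup_{w'}V_P(w')$, the supremum being over all contracts. **Proposition.** Suppose that $0<c_0<\mathbb{E}_{F_0}[y]$ and that $F_0$ has full support, $\operatorname{supp}F_0=\mathbb{R}_+$. Let $r_0$ be the index of $a_0$, i.e. the smallest solution of $c_0=\int[y-r_0]^+\,dF_0(y)$, and let $w_0(y)=[y-r_0]^+$ be the pure debt contract. Then $w_0$ is robustly optimal, and every robustly optimal contract $w$ satisfies $w=w_0$ $F_0$-almost everywhere. If moreover every $F_0$-null Borel subset of $\mathbb{R}_+$ has Lebesgue measure zero, then every robustly optimal contract $w$ satisfies $w=w_0$ Lebesgue-almost everywhere on $\mathbb{R}_+$. -/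

import Mathlib

open MeasureTheory
open scoped NNReal ENNReal

noncomputable section

/-- A project (Pandora's box): a prize distribution on `ℝ₊` with finite expectation,
and a cost of drawing from it. -/
structure Project where
  /-- the distribution of the prize -/
  law : Measure ℝ≥0
  isProb : IsProbabilityMeasure law
  mean_ne_top : ∫⁻ y, (y : ℝ≥0∞) ∂law ≠ ∞
  /-- the cost of one draw -/
  cost : ℝ≥0

attribute [instance] Project.isProb

/-- A wage contract: a measurable map from prizes to nonnegative wages
(limited liability is the codomain). -/
structure Contract where
  /-- the wage paid when the presented prize is `y` -/
  wage : ℝ≥0 → ℝ≥0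
  measurable_wage : Measurable wage

/-- The `z`-debt contract `y ↦ [y - z]⁺`. -/
def debtContract (z : ℝ) : Contract where
  wage y := Real.toNNReal ((y : ℝ) - z)
  measurable_wage := by fun_prop

/-- `r` is the index (reservation value) of the project `a`: the smallest solution of
`c = ∫ [y - r]⁺ dF(y)`. -/
def IsIndex (a : Project) (r : ℝ) : Prop :=
  IsLeast {x : ℝ | ∫ y, max ((y : ℝ) - x) 0 ∂a.law = (a.cost : ℝ)} r

/-- A search strategy when `k` projects are available and every project may be sampled any number
of times. Decisions depend on the list of all prizes drawn so far, the oldest first (which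
projects they came from is determined by this list and the strategy). -/
structure Strategy (k : ℕ) where
  /-- `some i`: sample project `i` next; `none`: cease searching -/
  next : List ℝ≥0 → Option (Fin k)
  /-- the prize that is presented if the search ceases -/
  present : List ℝ≥0 → ℝ≥0
  /-- recall: any drawn prize may be presented, and so may a prize of zero -/
  present_mem : ∀ h, present h = 0 ∨ present h ∈ h
  measurable_next : ∀ (t : ℕ) (d : Option (Fin k)),
    MeasurableSet {h : Fin t → ℝ≥0 | next (List.ofFn h) = d}
  measurable_present : ∀ t : ℕ, Measurable fun h : Fin t → ℝ≥0 => present (List.ofFn h)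

/-- The space of all draws: `ω (t, i)` is the prize obtained if the draw number `t` of the search
is from project `i`. -/
abbrev Draws (k : ℕ) : Type := ℕ × Fin k → ℝ≥0

/-- All draws are independent, and every draw from project `i` has the prize distribution of
project `i`. -/
def drawLaw {k : ℕ} (A : Fin k → Project) : Measure (Draws k) :=
  Measure.infinitePi fun p : ℕ × Fin k => (A p.2).law

namespace Strategy

variable {k : ℕ}

/-- The list of prizes drawn before period `t`; it no longer changes once the search has ceased. -/
def history (σ : Strategy k) (ω : Draws k) : ℕ → List ℝ≥0
  | 0 => []
  | t + 1 =>
    match σ.next (σ.history ω t) with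
    | none => σ.history ω t
    | some i => σ.history ω t ++ [ω (t, i)]

/-- The search ceases after finitely many draws. -/
def Stops (σ : Strategy k) (ω : Draws k) : Prop :=
  ∃ t, σ.next (σ.history ω t) = none

open Classical in
/-- The presented prize (only strategies that stop almost surely are ever considered). -/
def prize (σ : Strategy k) (ω : Draws k) : ℝ≥0 :=
  if h : σ.Stops ω then σ.present (σ.history ω (Nat.find h)) else 0

/-- The search cost incurred in period `t`. -/
def periodCost (σ : Strategy k) (A : Fin k → Project) (ω : Draws k) (t : ℕ) : ℝ≥0 :=
  match σ.next (σ.history ω t) with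
  | none => 0
  | some i => (A i).cost

/-- The total search cost; each draw is paid for. -/
def totalCost (σ : Strategy k) (A : Fin k → Project) (ω : Draws k) : ℝ≥0∞ :=
  ∑' t, (σ.periodCost A ω t : ℝ≥0∞)

/-- A strategy is admissible if the search ceases almost surely. -/
def Admissible (σ : Strategy k) (A : Fin k → Project) : Prop :=
  ∀ᵐ ω ∂drawLaw A, σ.Stops ω

/-- The agent's expected payoff `E[w(y)] - E[search costs]`; it is `⊥` if the expected search cost
is infinite (in `EReal`, `⊤ - ⊤ = ⊥`). -/
def agentPayoff (σ : Strategy k) (A : Fin k → Project) (w : Contract) : EReal :=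
  ((∫⁻ ω, (w.wage (σ.prize ω) : ℝ≥0∞) ∂drawLaw A : ℝ≥0∞) : EReal)
    - ((∫⁻ ω, σ.totalCost A ω ∂drawLaw A : ℝ≥0∞) : EReal)

/-- The principal's expected payoff `E[y - w(y)]`, as the difference of the expectations of the
positive and negative parts of `y - w(y)`. -/
def principalPayoff (σ : Strategy k) (A : Fin k → Project) (w : Contract) : EReal :=
  ((∫⁻ ω, ENNReal.ofReal ((σ.prize ω : ℝ) - (w.wage (σ.prize ω) : ℝ)) ∂drawLaw A : ℝ≥0∞) : EReal)
    - ((∫⁻ ω, ENNReal.ofReal ((w.wage (σ.prize ω) : ℝ) - (σ.prize ω : ℝ)) ∂drawLaw A : ℝ≥0∞) :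
        EReal)

end Strategy

/-- The agent's optimal search strategies. -/
def optimalStrategies {k : ℕ} (w : Contract) (A : Fin k → Project) : Set (Strategy k) :=
  {σ | σ.Admissible A ∧ ∀ τ : Strategy k, τ.Admissible A → τ.agentPayoff A w ≤ σ.agentPayoff A w}

/-- The least upper bound of the agent's expected payoff. -/
def agentValue {k : ℕ} (w : Contract) (A : Fin k → Project) : EReal :=
  ⨆ (σ : Strategy k) (_ : σ.Admissible A), σ.agentPayoff A w

open Classical in
/-- The principal's payoff `V_P(w ∣ A)`: the supremum of her expected payoff over the agent's
optimal strategies (ties are broken in her favour). If the agent has no optimal strategy, which is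
possible when a free project can be resampled forever, it is the limit, as the agent's payoff
approaches its least upper bound, of the supremum over nearly optimal strategies. -/
def principalValue {k : ℕ} (w : Contract) (A : Fin k → Project) : EReal :=
  if (optimalStrategies w A).Nonempty then
    ⨆ σ ∈ optimalStrategies w A, σ.principalPayoff A w
  else
    ⨅ (v : EReal) (_ : v < agentValue w A),
      ⨆ (σ : Strategy k) (_ : σ.Admissible A ∧ v < σ.agentPayoff A w), σ.principalPayoff A w

/-- The payoff guarantee `V_P(w)`: the infimum over all finite collections of projects that
contain the known project `a₀`, listed first. -/
def payoffGuarantee (a₀ : Project) (w : Contract) : EReal :=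
  ⨅ (n : ℕ) (others : Fin n → Project),
    principalValue w (Fin.cons a₀ others : Fin (n + 1) → Project)

/-- `w` is robustly optimal: it attains the maximal payoff guarantee. -/
def IsRobustlyOptimal (a₀ : Project) (w : Contract) : Prop :=
  payoffGuarantee a₀ w = ⨆ w' : Contract, payoffGuarantee a₀ w'

/-- Lebesgue measure on `ℝ₊`. -/
def lebesgueNN : Measure ℝ≥0 :=
  Measure.comap (fun y : ℝ≥0 => (y : ℝ)) volume

end

/-! ### Independence of the draws. -/

noncomputable section

/-! Let `ρ` be the index of the known project `a`. Three facts carry the proof.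

Upper bound. For any level `x ≥ g 0`, the presented prize satisfies `g(prize) ≤ x + ∑ (g(draw) -
x)⁺`. The decision to draw is independent of the prize drawn, so in expectation each draw
contributes its mean excess over `x` (`lintegral_prize_le`). With `g = id` and `x = ρ`, when `a` is
the only project, the expected prize is at most `ρ` plus the expected cost. The principal thus gets
at most `ρ` minus the agent's payoff, and the agent can secure a nonnegative one.

Attainment. Under the debt contract, a draw from `a` made while the best prize is below `ρ` raises
the expected wage by exactly its cost. Any strategy can therefore be continued with `a` until a
prize of at least `ρ` appears, at no loss to the agent (`agentPayoff_le_prolong`), and the principal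
then receives exactly `ρ`, whatever the other projects are.

Uniqueness. If `w` guarantees `ρ`, the agent gets nothing when `a` is alone, which forces `w 0 = 0`
and `E[w] = c` (`lintegral_wage_eq_cost`). If `w z > [z - ρ]⁺` for some `z`, a free project yielding
`z` makes the agent abandon `a`, leaving the principal `z - w z < ρ`. So `w` lies below the debt
contract everywhere and has the same mean under the law of `a`, hence equals it almost everywhere.
-/

instance {k : ℕ} (A : Fin k → Project) :
    IsProbabilityMeasure (drawLaw A) := by
  unfold drawLaw; infer_instance

/-- The prize of draw number `t` from project `i` is independent of every event that is determined
by the earlier draws. -/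
lemma lintegral_predictable_mul {k : ℕ} (A : Fin k → Project) (t : ℕ) (i : Fin k)
    {G : Set (Draws k)} (hG : MeasurableSet G)
    (hloc : ∀ ω ω' : Draws k, (∀ p : ℕ × Fin k, p.1 < t → ω p = ω' p) → (ω ∈ G ↔ ω' ∈ G))
    {g : ℝ≥0 → ℝ≥0∞} (hg : Measurable g) :
    ∫⁻ ω, G.indicator 1 ω * g (ω (t, i)) ∂drawLaw A
      = drawLaw A G * ∫⁻ y, g y ∂(A i).law := by
  classical
  let S : Finset (ℕ × Fin k) := Finset.range t ×ˢ Finset.univ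
  let T : Finset (ℕ × Fin k) := {(t, i)}
  have hST : Disjoint S T := by
    rw [Finset.disjoint_singleton_right]
    simp [S]
  have hind := (ProbabilityTheory.iIndepFun_infinitePi
    (P := fun p : ℕ × Fin k => (A p.2).law) (X := fun _ => id)
    (fun _ => measurable_id)).indepFun_finset S T hST (fun p => measurable_pi_apply p)
  let ext : (S → ℝ≥0) → Draws k := fun f p => if h : p ∈ S then f ⟨p, h⟩ else 0
  have hext : Measurable ext := by
    refine measurable_pi_lambda _ fun p => ?_
    by_cases h : p ∈ S
    · simpa [ext, h] using measurable_pi_apply _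
    · simp [ext, h]
  have key : ∀ ω : Draws k, G.indicator (1 : Draws k → ℝ≥0∞) ω
      = (ext ⁻¹' G).indicator 1 (fun p : S => ω p) := by
    intro ω
    have : ω ∈ G ↔ ext (fun p : S => ω p) ∈ G := by
      apply hloc
      intro p hp
      have : p ∈ S := by simpa [S] using hp
      simp [ext, this]
    by_cases h : ω ∈ G
    · rw [Set.indicator_of_mem h, Set.indicator_of_mem (by exact this.1 h)]; rfl
    · rw [Set.indicator_of_notMem h, Set.indicator_of_notMem (by exact fun h' => h (this.2 h'))]
  have hI := hind.comp
    (φ := fun f : S → ℝ≥0 => (ext ⁻¹' G).indicator (1 : (S → ℝ≥0) → ℝ≥0∞) f)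
    (ψ := fun f : T → ℝ≥0 => g (f ⟨(t, i), by simp [T]⟩))
    (measurable_one.indicator (hext hG)) (by fun_prop)
  have h1 := ProbabilityTheory.lintegral_mul_eq_lintegral_mul_lintegral_of_indepFun
    (μ := drawLaw A) (f := fun ω => G.indicator 1 ω) (g := fun ω => g (ω (t, i)))
    (measurable_one.indicator hG) (by fun_prop)
    (by
      have : (fun ω : Draws k => G.indicator (1 : Draws k → ℝ≥0∞) ω) =
        fun ω => (ext ⁻¹' G).indicator 1 (fun p : S => ω p) := funext key
      rw [this]
      exact hI)
  have h2 : ∫⁻ ω, g (ω (t, i)) ∂drawLaw A = ∫⁻ y, g y ∂(A i).law := by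
    have := measurePreserving_eval_infinitePi (fun p : ℕ × Fin k => (A p.2).law) (t, i)
    exact this.lintegral_comp hg
  have h3 : ∫⁻ ω, G.indicator 1 ω ∂drawLaw A = drawLaw A G := lintegral_indicator_one hG
  simpa only [Pi.mul_apply, h2, h3] using h1

/-! ### Histories, measurability and the excess bound. -/

namespace Strategy
variable {k : ℕ} (σ : Strategy k)

lemma history_succ_of_none {ω : Draws k} {t : ℕ} (h : σ.next (σ.history ω t) = none) :
    σ.history ω (t + 1) = σ.history ω t := by
  simp [history, h]

lemma history_succ_of_some {ω : Draws k} {t : ℕ} {i : Fin k}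
    (h : σ.next (σ.history ω t) = some i) :
    σ.history ω (t + 1) = σ.history ω t ++ [ω (t, i)] := by
  simp [history, h]

lemma history_eq_of_le {ω : Draws k} {s t : ℕ} (h : σ.next (σ.history ω s) = none)
    (hst : s ≤ t) : σ.history ω t = σ.history ω s := by
  induction t, hst using Nat.le_induction with
  | base => rfl
  | succ t _ ih => rw [σ.history_succ_of_none (by rw [ih, h]), ih]

lemma next_history_eq_none_of_le {ω : Draws k} {s t : ℕ} (h : σ.next (σ.history ω s) = none)
    (hst : s ≤ t) : σ.next (σ.history ω t) = none := by
  rw [σ.history_eq_of_le h hst, h]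

/-- The presented prize may be read off at any time after the search has ceased. -/
lemma prize_eq {ω : Draws k} {t : ℕ} (h : σ.next (σ.history ω t) = none) :
    σ.prize ω = σ.present (σ.history ω t) := by
  classical
  have hs : σ.Stops ω := ⟨t, h⟩
  rw [prize, dif_pos hs, σ.history_eq_of_le (Nat.find_spec hs) (Nat.find_min' hs h)]

lemma history_congr {ω ω' : Draws k} {t : ℕ}
    (h : ∀ p : ℕ × Fin k, p.1 < t → ω p = ω' p) : σ.history ω t = σ.history ω' t := by
  induction t with
  | zero => rfl
  | succ t ih =>
    have ih := ih fun p hp => h p (by omega)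
    simp only [history, ih]
    cases σ.next (σ.history ω' t) with
    | none => rfl
    | some i => simp only [h (t, i) (Nat.lt_succ_self t)]

lemma exists_of_mem_history {ω : Draws k} {t : ℕ} {y : ℝ≥0} (h : y ∈ σ.history ω t) :
    ∃ s i, σ.next (σ.history ω s) = some i ∧ y = ω (s, i) := by
  induction t with
  | zero => simp [history] at h
  | succ t ih =>
    cases hd : σ.next (σ.history ω t) with
    | none => exact ih (σ.history_succ_of_none hd ▸ h)
    | some i =>
      rw [σ.history_succ_of_some hd, List.mem_append, List.mem_singleton] at h
      exact h.elim ih fun h => ⟨t, i, hd, h⟩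

open Classical in
/-- The prize drawn in period `t`, and `0` if the search has ceased. -/
def drawn (ω : Draws k) (t : ℕ) : ℝ≥0 :=
  ∑ i, if σ.next (σ.history ω t) = some i then ω (t, i) else 0

/-- Strategies are assumed measurable only on lists of a fixed length. As long as the search runs,
the history has length exactly `t`, so this form makes that assumption applicable. -/
lemma history_eq_ofFn {ω : Draws k} {t : ℕ}
    (h : ∀ s < t, σ.next (σ.history ω s) ≠ none) :
    σ.history ω t = List.ofFn fun s : Fin t => σ.drawn ω s := by
  induction t with
  | zero => simp [history]
  | succ t ih =>
    obtain ⟨i, hi⟩ := Option.ne_none_iff_exists'.1 (h t (Nat.lt_succ_self t))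
    rw [σ.history_succ_of_some hi, List.ofFn_succ_last, ih fun s hs => h s (by omega)]
    simp [drawn, hi]

lemma measurableSet_next_history (t : ℕ) (d : Option (Fin k)) :
    MeasurableSet {ω : Draws k | σ.next (σ.history ω t) = d} := by
  classical
  induction t using Nat.strong_induction_on generalizing d with
  | _ t ih =>
    have hv : Measurable fun (ω : Draws k) (s : Fin t) => σ.drawn ω s := by
      refine measurable_pi_lambda _ fun s => ?_
      unfold drawn
      exact Finset.measurable_fun_sum _ fun i _ =>
        Measurable.ite (ih s s.2 _) (measurable_pi_apply _) measurable_const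
    have hN : MeasurableSet {ω : Draws k | ∃ s < t, σ.next (σ.history ω s) = none} := by
      have : {ω : Draws k | ∃ s < t, σ.next (σ.history ω s) = none}
          = ⋃ s : ℕ, ⋃ _ : s < t, {ω : Draws k | σ.next (σ.history ω s) = none} := by
        ext; simp
      rw [this]
      exact MeasurableSet.iUnion fun s => MeasurableSet.iUnion fun hs => ih s hs none
    have : {ω : Draws k | σ.next (σ.history ω t) = d}
        = ({ω : Draws k | ∃ s < t, σ.next (σ.history ω s) = none} ∩ {_ω | d = none}) ∪
          ({ω : Draws k | ∃ s < t, σ.next (σ.history ω s) = none}ᶜ ∩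
            (fun (ω : Draws k) (s : Fin t) => σ.drawn ω s) ⁻¹'
              {h : Fin t → ℝ≥0 | σ.next (List.ofFn h) = d}) := by
      ext ω
      by_cases h : ∃ s < t, σ.next (σ.history ω s) = none
      · obtain ⟨s, hs, hn⟩ := id h
        simp only [Set.mem_ofPred_eq, Set.mem_union, Set.mem_inter_iff, Set.mem_compl_iff, h,
          not_true_eq_false, false_and, or_false, true_and,
          σ.next_history_eq_none_of_le hn hs.le]
        exact eq_comm
      · have h' : ∀ s < t, σ.next (σ.history ω s) ≠ none := fun s hs hn => h ⟨s, hs, hn⟩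
        simp only [Set.mem_ofPred_eq, Set.mem_union, Set.mem_inter_iff, Set.mem_compl_iff, h,
          not_false_eq_true, false_and, false_or, true_and, Set.mem_preimage,
          σ.history_eq_ofFn h']
    rw [this]
    exact (hN.inter (MeasurableSet.const _)).union
      (hN.compl.inter (hv (σ.measurable_next t d)))

lemma measurable_drawn (t : ℕ) : Measurable fun ω : Draws k => σ.drawn ω t := by
  classical
  unfold drawn
  exact Finset.measurable_fun_sum _ fun i _ =>
    Measurable.ite (σ.measurableSet_next_history t _) (measurable_pi_apply _) measurable_const

lemma measurable_prize : Measurable fun ω : Draws k => σ.prize ω := by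
  classical
  let F : ℕ → Set (Draws k) := fun t => {ω | σ.next (σ.history ω t) = none} ∩
    ⋂ s : ℕ, ⋂ _ : s < t, {ω | σ.next (σ.history ω s) = none}ᶜ
  have hF : ∀ t, MeasurableSet (F t) := fun t => (σ.measurableSet_next_history t none).inter
    (MeasurableSet.iInter fun s => MeasurableSet.iInter fun _ =>
      (σ.measurableSet_next_history s none).compl)
  have hS : MeasurableSet {ω : Draws k | σ.Stops ω} := by
    have : {ω : Draws k | σ.Stops ω} = ⋃ t, {ω | σ.next (σ.history ω t) = none} := by
      ext; simp [Stops]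
    rw [this]
    exact MeasurableSet.iUnion fun t => σ.measurableSet_next_history t none
  intro B hB
  have : (fun ω : Draws k => σ.prize ω) ⁻¹' B
      = (⋃ t, F t ∩ (fun ω : Draws k => σ.present (List.ofFn fun s : Fin t => σ.drawn ω s)) ⁻¹' B)
        ∪ ({ω : Draws k | σ.Stops ω}ᶜ ∩ {_ω | (0 : ℝ≥0) ∈ B}) := by
    ext ω
    have hpr : ∀ t, ω ∈ F t →
        σ.prize ω = σ.present (List.ofFn fun s : Fin t => σ.drawn ω s) := by
      intro t ht
      have h1 : σ.next (σ.history ω t) = none := ht.1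
      have h2 : ∀ s < t, σ.next (σ.history ω s) ≠ none := by simpa using ht.2
      rw [σ.prize_eq h1, σ.history_eq_ofFn h2]
    by_cases h : σ.Stops ω
    · have hf : ω ∈ F (Nat.find h) := by
        refine ⟨Nat.find_spec h, ?_⟩
        simpa using fun s hs => Nat.find_min h (m := s) (by simpa using hs)
      simp only [Set.mem_preimage, Set.mem_union, Set.mem_iUnion, Set.mem_inter_iff,
        Set.mem_compl_iff, Set.mem_ofPred_eq, h, not_true_eq_false, false_and, or_false]
      constructor
      · exact fun hB => ⟨_, hf, hpr _ hf ▸ hB⟩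
      · rintro ⟨t, ht, hB⟩
        rwa [hpr t ht]
    · have hf : ∀ t, ω ∉ F t := fun t ht => h ⟨t, ht.1⟩
      simp [h, hf, prize]
  rw [this]
  refine (MeasurableSet.iUnion fun t => (hF t).inter ?_).union (hS.compl.inter (.const _))
  have hm : Measurable fun ω : Draws k => σ.present (List.ofFn fun s : Fin t => σ.drawn ω s) :=
    (σ.measurable_present t).comp (measurable_pi_lambda _ fun s => σ.measurable_drawn s)
  exact hm hB

/-- The expected number of draws from project `i`. -/
def drawCount (A : Fin k → Project) (i : Fin k) : ℝ≥0∞ :=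
  ∑' t, drawLaw A {ω | σ.next (σ.history ω t) = some i}

lemma lintegral_totalCost (A : Fin k → Project) :
    ∫⁻ ω, σ.totalCost A ω ∂drawLaw A = ∑ i, σ.drawCount A i * (A i).cost := by
  classical
  have hp : ∀ ω t, (σ.periodCost A ω t : ℝ≥0∞) = ∑ i,
      {ω : Draws k | σ.next (σ.history ω t) = some i}.indicator
        (fun _ => ((A i).cost : ℝ≥0∞)) ω := by
    intro ω t
    cases h : σ.next (σ.history ω t) <;> simp [periodCost, h, Set.indicator_apply]
  have hm : ∀ t i, Measurable fun ω => {ω : Draws k | σ.next (σ.history ω t) = some i}.indicator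
        (fun _ => ((A i).cost : ℝ≥0∞)) ω := fun t i =>
    measurable_const.indicator (σ.measurableSet_next_history t _)
  simp only [totalCost, hp, drawCount]
  rw [lintegral_tsum fun t => (Finset.measurable_fun_sum _ fun i _ => hm t i).aemeasurable]
  simp_rw [lintegral_finsetSum _ fun i _ => hm _ i]
  rw [Summable.tsum_finsetSum fun _ _ => ENNReal.summable]
  refine Finset.sum_congr rfl fun i _ => ?_
  rw [← ENNReal.tsum_mul_right]
  refine tsum_congr fun t => ?_
  rw [lintegral_indicator_const (σ.measurableSet_next_history t _), mul_comm]

/-- Stopping at the first prize above `x` cannot be improved upon by more than what the excess of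
each draw over `x` is worth. -/
lemma lintegral_prize_le (A : Fin k → Project) {g : ℝ≥0 → ℝ≥0∞} (hg : Measurable g)
    {x : ℝ≥0∞} (hx : g 0 ≤ x) :
    ∫⁻ ω, g (σ.prize ω) ∂drawLaw A
      ≤ x + ∑ i, σ.drawCount A i * ∫⁻ y, (g y - x) ∂(A i).law := by
  classical
  let G : ℕ → Fin k → Set (Draws k) := fun t i => {ω | σ.next (σ.history ω t) = some i}
  have hG : ∀ t i, MeasurableSet (G t i) := fun t i => σ.measurableSet_next_history t _
  have hgx : Measurable fun y => g y - x := hg.sub measurable_const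
  have hm : ∀ t i, Measurable fun ω : Draws k => (G t i).indicator 1 ω * (g (ω (t, i)) - x) :=
    fun t i => (measurable_one.indicator (hG t i)).mul (hgx.comp (measurable_pi_apply (t, i)))
  calc ∫⁻ ω, g (σ.prize ω) ∂drawLaw A
      ≤ ∫⁻ ω, (x + ∑' t, ∑ i, (G t i).indicator 1 ω * (g (ω (t, i)) - x)) ∂drawLaw A := by
        -- Pointwise, only the term of the draw that is presented is needed; all other terms are
        -- nonnegative.
        refine lintegral_mono fun ω => ?_
        have h0 : σ.prize ω = 0 ∨ ∃ s i, ω ∈ G s i ∧ σ.prize ω = ω (s, i) := by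
          by_cases h : σ.Stops ω
          · obtain ⟨t, ht⟩ := h
            rw [σ.prize_eq ht]
            exact (σ.present_mem _).imp id σ.exists_of_mem_history
          · exact .inl (by simp [prize, h])
        rcases h0 with h0 | ⟨s, i, hs, h0⟩
        · rw [h0]; exact hx.trans le_self_add
        · rw [h0]
          calc g (ω (s, i)) ≤ x + (g (ω (s, i)) - x) := le_add_tsub
            _ ≤ _ := by
              gcongr
              refine le_trans ?_ (ENNReal.le_tsum s)
              refine le_trans ?_ (Finset.single_le_sum (fun _ _ => zero_le) (Finset.mem_univ i))
              simp [Set.indicator_of_mem hs]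
    _ = x + ∑ i, σ.drawCount A i * ∫⁻ y, (g y - x) ∂(A i).law := by
        rw [lintegral_add_left measurable_const, lintegral_const, measure_univ, mul_one,
          lintegral_tsum fun t => (Finset.measurable_fun_sum _ fun i _ => hm t i).aemeasurable]
        simp_rw [lintegral_finsetSum _ fun i _ => hm _ i]
        rw [Summable.tsum_finsetSum fun _ _ => ENNReal.summable]
        congr 1
        refine Finset.sum_congr rfl fun i _ => ?_
        rw [drawCount, ← ENNReal.tsum_mul_right]
        refine tsum_congr fun t => ?_
        refine lintegral_predictable_mul A t i (hG t i) (fun ω ω' h => ?_) hgx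
        simp only [G, Set.mem_ofPred_eq, σ.history_congr h]

end Strategy

/-! ### Payoff bounds for a single strategy. -/

lemma EReal.coe_lt_coe_ennreal_sub {v : ℝ} {a c : ℝ≥0∞} (h : (v : EReal) < (a : EReal) - c) :
    c ≠ ∞ ∧ (v : EReal) + c ≤ a := by
  have hc : c ≠ ∞ := by
    rintro rfl
    simp [EReal.sub_top] at h
  refine ⟨hc, ?_⟩
  exact EReal.add_le_of_le_sub h.le

namespace Strategy
variable {k : ℕ} (σ : Strategy k) {A : Fin k → Project} {w : Contract}

lemma principalPayoff_le {Y : ℝ≥0∞} (hY : Y ≠ ∞)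
    (h : ∫⁻ ω, (σ.prize ω : ℝ≥0∞) ∂drawLaw A ≤ Y) :
    σ.principalPayoff A w
      ≤ (Y : EReal) - ((∫⁻ ω, (w.wage (σ.prize ω) : ℝ≥0∞) ∂drawLaw A : ℝ≥0∞) : EReal) := by
  have hmP : Measurable fun ω =>
      ENNReal.ofReal ((σ.prize ω : ℝ) - (w.wage (σ.prize ω) : ℝ)) :=
    (σ.measurable_prize.coe_nnreal_real.sub
      (w.measurable_wage.comp σ.measurable_prize).coe_nnreal_real).ennreal_ofReal
  have hmN : Measurable fun ω =>
      ENNReal.ofReal ((w.wage (σ.prize ω) : ℝ) - (σ.prize ω : ℝ)) :=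
    ((w.measurable_wage.comp σ.measurable_prize).coe_nnreal_real.sub
      σ.measurable_prize.coe_nnreal_real).ennreal_ofReal
  have hsum : ∫⁻ ω, ENNReal.ofReal ((σ.prize ω : ℝ) - (w.wage (σ.prize ω) : ℝ)) ∂drawLaw A
        + ∫⁻ ω, (w.wage (σ.prize ω) : ℝ≥0∞) ∂drawLaw A
      = ∫⁻ ω, ENNReal.ofReal ((w.wage (σ.prize ω) : ℝ) - (σ.prize ω : ℝ)) ∂drawLaw A
        + ∫⁻ ω, (σ.prize ω : ℝ≥0∞) ∂drawLaw A := by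
    rw [← lintegral_add_left hmP, ← lintegral_add_left hmN]
    refine lintegral_congr fun ω => ?_
    generalize σ.prize ω = y
    generalize w.wage y = u
    rw [← ENNReal.ofReal_coe_nnreal (p := y), ← ENNReal.ofReal_coe_nnreal (p := u)]
    rcases le_total (y : ℝ) u with hyu | hyu
    · rw [ENNReal.ofReal_of_nonpos (by linarith), zero_add,
        ← ENNReal.ofReal_add (by linarith) y.coe_nonneg, sub_add_cancel]
    · rw [ENNReal.ofReal_of_nonpos (p := (u : ℝ) - y) (by linarith), zero_add,
        ← ENNReal.ofReal_add (by linarith) u.coe_nonneg, sub_add_cancel]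
  have hPE : ∫⁻ ω, ENNReal.ofReal ((σ.prize ω : ℝ) - (w.wage (σ.prize ω) : ℝ)) ∂drawLaw A
      ≤ ∫⁻ ω, (σ.prize ω : ℝ≥0∞) ∂drawLaw A := by
    refine lintegral_mono fun ω => ?_
    rw [← ENNReal.ofReal_coe_nnreal (p := σ.prize ω)]
    exact ENNReal.ofReal_le_ofReal (sub_le_self _ (NNReal.coe_nonneg _))
  unfold principalPayoff
  generalize ∫⁻ ω, ENNReal.ofReal ((σ.prize ω : ℝ) - (w.wage (σ.prize ω) : ℝ)) ∂drawLaw A = P at *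
  generalize ∫⁻ ω, ENNReal.ofReal ((w.wage (σ.prize ω) : ℝ) - (σ.prize ω : ℝ)) ∂drawLaw A = N at *
  generalize ∫⁻ ω, (w.wage (σ.prize ω) : ℝ≥0∞) ∂drawLaw A = W at *
  generalize ∫⁻ ω, (σ.prize ω : ℝ≥0∞) ∂drawLaw A = E at *
  have hE : E ≠ ∞ := ne_top_of_le_ne_top hY h
  have hP : P ≠ ∞ := ne_top_of_le_ne_top hE hPE
  by_cases hN : N = ∞
  · simp [hN, EReal.sub_top]
  have hW : W ≠ ∞ := fun hW => by
    rw [hW, add_top] at hsum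
    exact ENNReal.add_ne_top.2 ⟨hN, hE⟩ hsum.symm
  lift P to ℝ≥0 using hP
  lift N to ℝ≥0 using hN
  lift W to ℝ≥0 using hW
  lift E to ℝ≥0 using hE
  lift Y to ℝ≥0 using hY
  have h1 : (P : ℝ) + W = N + E := by exact_mod_cast hsum
  have h2 : (E : ℝ) ≤ Y := by exact_mod_cast h
  simp only [EReal.coe_nnreal_eq_coe_real, ← EReal.coe_sub, EReal.coe_le_coe_iff]
  linarith

/-- If the expected prize is at most `ρ` plus the expected search cost, the principal cannot get
more than what the agent leaves of `ρ`. -/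
lemma principalPayoff_le_sub {ρ : ℝ≥0} {v : ℝ}
    (h : ∫⁻ ω, (σ.prize ω : ℝ≥0∞) ∂drawLaw A ≤ ρ + ∫⁻ ω, σ.totalCost A ω ∂drawLaw A)
    (hv : (v : EReal) < σ.agentPayoff A w) :
    σ.principalPayoff A w ≤ ((ρ - v : ℝ) : EReal) := by
  obtain ⟨hC, hv⟩ := EReal.coe_lt_coe_ennreal_sub hv
  refine (σ.principalPayoff_le (ENNReal.add_ne_top.2 ⟨ENNReal.coe_ne_top, hC⟩) h).trans ?_
  refine (EReal.sub_le_sub le_rfl hv).trans ?_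
  generalize ∫⁻ ω, σ.totalCost A ω ∂drawLaw A = C at *
  lift C to ℝ≥0 using hC
  rw [EReal.coe_ennreal_add]
  simp only [EReal.coe_nnreal_eq_coe_real, ← EReal.coe_sub, ← EReal.coe_add,
    EReal.coe_le_coe_iff]
  linarith

/-- The excess bound with `g = w.wage`: when no project's expected excess wage over `x` exceeds its
cost, draws cannot pay for themselves beyond `x`. -/
lemma agentPayoff_le {x : ℝ≥0} (hx : w.wage 0 ≤ x)
    (h : ∀ i, ∫⁻ y, ((w.wage y : ℝ≥0∞) - x) ∂(A i).law ≤ (A i).cost) :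
    σ.agentPayoff A w ≤ (x : EReal) := by
  have h1 : ∫⁻ ω, (w.wage (σ.prize ω) : ℝ≥0∞) ∂drawLaw A
      ≤ x + ∫⁻ ω, σ.totalCost A ω ∂drawLaw A := by
    refine (σ.lintegral_prize_le A w.measurable_wage.coe_nnreal_ennreal
      (x := x) (by exact_mod_cast hx)).trans ?_
    rw [lintegral_totalCost]
    gcongr with i
    exact h i
  unfold agentPayoff
  refine EReal.sub_le_of_le_add ?_
  have h2 := EReal.coe_ennreal_le_coe_ennreal_iff.2 h1
  rwa [EReal.coe_ennreal_add] at h2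

/-- A project whose index is below the payoff that the agent attains is never sampled. -/
lemma drawCount_eq_zero {x : ℝ≥0} (hx : w.wage 0 ≤ x)
    (h : ∀ i, ∫⁻ y, ((w.wage y : ℝ≥0∞) - x) ∂(A i).law ≤ (A i).cost)
    (hU : (x : EReal) ≤ σ.agentPayoff A w) {i : Fin k}
    (hi : ∫⁻ y, ((w.wage y : ℝ≥0∞) - x) ∂(A i).law < (A i).cost) :
    σ.drawCount A i = 0 := by
  classical
  have h1 := σ.lintegral_prize_le A w.measurable_wage.coe_nnreal_ennreal
      (x := x) (by exact_mod_cast hx)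
  have hC : ∫⁻ ω, σ.totalCost A ω ∂drawLaw A ≠ ∞ := by
    intro hC
    simp [agentPayoff, hC, EReal.sub_top] at hU
  have h2 : x + ∫⁻ ω, σ.totalCost A ω ∂drawLaw A
      ≤ ∫⁻ ω, (w.wage (σ.prize ω) : ℝ≥0∞) ∂drawLaw A := by
    rw [← EReal.coe_ennreal_le_coe_ennreal_iff, EReal.coe_ennreal_add]
    exact EReal.add_le_of_le_sub hU
  -- Expected costs are at most the expected excesses, while project by project the reverse
  -- inequality holds, strictly for `i`. So `i` cannot have a positive expected number of draws;
  -- finiteness of the cost keeps that strictness.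
  have h3 := (ENNReal.add_le_add_iff_left ENNReal.coe_ne_top).1 (h2.trans h1)
  rw [lintegral_totalCost] at h3 hC
  by_contra h0
  rw [← Finset.add_sum_erase _ _ (Finset.mem_univ i),
    ← Finset.add_sum_erase _ _ (Finset.mem_univ i)] at h3
  rw [← Finset.add_sum_erase _ _ (Finset.mem_univ i), ENNReal.add_ne_top] at hC
  have hci : ((A i).cost : ℝ≥0∞) ≠ 0 := (pos_of_gt hi).ne'
  have hfin : σ.drawCount A i ≠ ∞ := fun ht => hC.1 (by rw [ht, ENNReal.top_mul hci])
  refine h3.not_gt (ENNReal.add_lt_add_of_lt_of_le ?_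
    (ENNReal.mul_lt_mul_right h0 hfin hi) ?_)
  · exact ne_top_of_le_ne_top hC.2 (Finset.sum_le_sum fun j _ => by gcongr; exact h j)
  · exact Finset.sum_le_sum fun j _ => by gcongr; exact h j

/-- The strategy that never searches. -/
def stopAtOnce (k : ℕ) : Strategy k where
  next _ := none
  present _ := 0
  present_mem _ := .inl rfl
  measurable_next _ _ := .const _
  measurable_present _ := measurable_const

/-- The strategy that draws from project `i` once and presents the prize. -/
def sampleOnce (i : Fin k) : Strategy k where
  next
    | [] => some i
    | _ :: _ => none
  present
    | [] => 0
    | y :: _ => y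
  present_mem := by rintro (_ | ⟨y, h⟩) <;> simp
  measurable_next t d := by
    cases t <;> simp [List.ofFn_succ]
  measurable_present t := by
    cases t with
    | zero => simp
    | succ t => simpa [List.ofFn_succ] using measurable_pi_apply 0

lemma admissible_stopAtOnce : (stopAtOnce k).Admissible A :=
  .of_forall fun _ => ⟨0, rfl⟩

lemma agentPayoff_stopAtOnce : (stopAtOnce k).agentPayoff A w = (w.wage 0 : EReal) := by
  have h1 : ∀ ω : Draws k, (stopAtOnce k).prize ω = 0 := fun ω => prize_eq _ (t := 0) rfl
  have h2 : ∀ ω : Draws k, (stopAtOnce k).totalCost A ω = 0 := fun ω => by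
    simp [totalCost, periodCost, stopAtOnce]
  simp [agentPayoff, h1, h2]

lemma admissible_sampleOnce (i : Fin k) : (sampleOnce i).Admissible A :=
  .of_forall fun _ => ⟨1, rfl⟩

lemma agentPayoff_sampleOnce (i : Fin k) : (sampleOnce i).agentPayoff A w
    = ((∫⁻ y, (w.wage y : ℝ≥0∞) ∂(A i).law : ℝ≥0∞) : EReal) - ((A i).cost : EReal) := by
  have h1 : ∀ ω : Draws k, (sampleOnce i).prize ω = ω (0, i) := fun ω => prize_eq _ (t := 1) rfl
  have h2 : ∀ ω : Draws k, (sampleOnce i).totalCost A ω = (A i).cost := fun ω => by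
    rw [totalCost, tsum_eq_single 0]
    · rfl
    · intro t ht
      have : (sampleOnce i).next ((sampleOnce i).history ω t) = none :=
        next_history_eq_none_of_le _ (s := 1) rfl (by omega)
      simp [periodCost, this]
  have h3 := (measurePreserving_eval_infinitePi (fun p : ℕ × Fin k => (A p.2).law)
    (0, i)).lintegral_comp w.measurable_wage.coe_nnreal_ennreal
  simp only [agentPayoff, h1, h2]
  rw [lintegral_const, measure_univ, mul_one]
  exact congrArg (fun x : ℝ≥0∞ => (x : EReal) - ((A i).cost : EReal)) h3

end Strategy

/-! ### Bounding the principal's value over the agent's best responses. -/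

section Values
variable {k : ℕ} {A : Fin k → Project} {w : Contract}

lemma Strategy.Admissible.agentPayoff_le_agentValue {σ : Strategy k} (h : σ.Admissible A) :
    σ.agentPayoff A w ≤ agentValue w A :=
  le_iSup₂_of_le σ h le_rfl

/-- Optimal strategies also exceed `v`, so a bound on near-optimal strategies covers both cases of
the definition. -/
lemma principalValue_le_of_lt {v : EReal} (hv : v < agentValue w A) {b : EReal}
    (h : ∀ σ : Strategy k, σ.Admissible A → v < σ.agentPayoff A w → σ.principalPayoff A w ≤ b) :
    principalValue w A ≤ b := by
  unfold principalValue
  split_ifs with hne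
  · refine iSup₂_le fun σ hσ => h σ hσ.1 (hv.trans_le ?_)
    exact iSup₂_le fun τ hτ => hσ.2 τ hτ
  · exact iInf₂_le_of_le v hv (iSup₂_le fun σ hσ => h σ hσ.1 hσ.2)

/-- A known maximizer excludes the limiting case, so only strategies attaining the exact optimum
matter; `drawCount_eq_zero` needs this exactness. -/
lemma principalValue_le_of_isMax {τ : Strategy k} (hτ : τ.Admissible A)
    (hmax : ∀ σ : Strategy k, σ.Admissible A → σ.agentPayoff A w ≤ τ.agentPayoff A w)
    {b : EReal} (h : ∀ σ : Strategy k, τ.agentPayoff A w ≤ σ.agentPayoff A w →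
      σ.principalPayoff A w ≤ b) :
    principalValue w A ≤ b := by
  unfold principalValue
  rw [if_pos ⟨τ, hτ, hmax⟩]
  exact iSup₂_le fun σ hσ => h σ (hσ.2 τ hτ)

end Values

/-! ### The index as upper bound, and uniqueness of the contract attaining it. -/

section Guarantee
variable {a : Project} {ρ : ℝ≥0} {w : Contract}

/-- The project that yields the prize `y` for free. -/
def freePrize (y : ℝ≥0) : Project where
  law := Measure.dirac y
  isProb := inferInstance
  mean_ne_top := by simp
  cost := 0

lemma payoffGuarantee_le {n : ℕ} (others : Fin n → Project) :
    payoffGuarantee a w ≤ principalValue w (Fin.cons a others : Fin (n + 1) → Project) :=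
  (iInf_le (fun n : ℕ => ⨅ others : Fin n → Project,
    principalValue w (Fin.cons a others : Fin (n + 1) → Project)) n).trans (iInf_le _ others)

/-- The principal and the agent together cannot get more than the index of the only project. -/
lemma payoffGuarantee_le_sub (hρ : ∫⁻ y, ((y : ℝ≥0∞) - ρ) ∂a.law = a.cost) {v : ℝ}
    (hv : (v : EReal) < agentValue w (Fin.cons a Fin.elim0 : Fin 1 → Project)) :
    payoffGuarantee a w ≤ ((ρ - v : ℝ) : EReal) := by
  refine (payoffGuarantee_le Fin.elim0).trans (principalValue_le_of_lt hv fun σ _ hσv => ?_)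
  refine σ.principalPayoff_le_sub ?_ hσv
  refine (σ.lintegral_prize_le _ (g := fun y => (y : ℝ≥0∞)) measurable_coe_nnreal_ennreal
    (x := ρ) (by simp)).trans_eq ?_
  rw [σ.lintegral_totalCost]
  simp [hρ]

lemma wage_zero_le_agentValue {k : ℕ} (A : Fin k → Project) :
    (w.wage 0 : EReal) ≤ agentValue w A := by
  rw [← Strategy.agentPayoff_stopAtOnce (A := A)]
  exact Strategy.admissible_stopAtOnce.agentPayoff_le_agentValue

lemma payoffGuarantee_le_index (hρ : ∫⁻ y, ((y : ℝ≥0∞) - ρ) ∂a.law = a.cost) :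
    payoffGuarantee a w ≤ ((ρ : ℝ) : EReal) := by
  by_contra! h
  obtain ⟨z, hz, hzV⟩ := EReal.lt_iff_exists_real_btwn.1 h
  refine hzV.not_ge ?_
  -- Since `z > ρ`, the level `ρ - z` is negative, and the agent's value is at least `w 0 ≥ 0`.
  have hv : ((ρ - z : ℝ) : EReal)
      < agentValue w (Fin.cons a Fin.elim0 : Fin 1 → Project) := by
    refine lt_of_lt_of_le ?_ (wage_zero_le_agentValue _)
    refine lt_of_lt_of_le ?_ (EReal.coe_ennreal_nonneg _)
    rw [EReal.coe_lt_coe_iff] at hz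
    exact_mod_cast sub_neg.2 hz
  simpa using payoffGuarantee_le_sub hρ hv

lemma agentValue_le_zero_of_index_le (hρ : ∫⁻ y, ((y : ℝ≥0∞) - ρ) ∂a.law = a.cost)
    (h : ((ρ : ℝ) : EReal) ≤ payoffGuarantee a w) :
    agentValue w (Fin.cons a Fin.elim0 : Fin 1 → Project) ≤ 0 := by
  by_contra! h0
  obtain ⟨v, hv, hvU⟩ := EReal.lt_iff_exists_real_btwn.1 h0
  have := h.trans (payoffGuarantee_le_sub hρ hvU)
  rw [EReal.coe_le_coe_iff] at this
  have hv : 0 < v := by exact_mod_cast hv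
  linarith

lemma wage_zero_eq_zero_of_index_le (hρ : ∫⁻ y, ((y : ℝ≥0∞) - ρ) ∂a.law = a.cost)
    (h : ((ρ : ℝ) : EReal) ≤ payoffGuarantee a w) : w.wage 0 = 0 := by
  have := (wage_zero_le_agentValue _).trans (agentValue_le_zero_of_index_le hρ h)
  have h2 : ((w.wage 0 : ℝ≥0∞) : EReal) ≤ ((0 : ℝ≥0∞) : EReal) := by simpa using this
  rw [EReal.coe_ennreal_le_coe_ennreal_iff] at h2
  simpa using h2

/-- With `a` alone, a larger mean wage would let a single draw leave the agent a positive rent; with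
a smaller one he never searches and the principal gets at most `0 < ρ`. -/
lemma lintegral_wage_eq_cost (hρ : ∫⁻ y, ((y : ℝ≥0∞) - ρ) ∂a.law = a.cost) (hρ0 : 0 < ρ)
    (h : ((ρ : ℝ) : EReal) ≤ payoffGuarantee a w) :
    ∫⁻ y, (w.wage y : ℝ≥0∞) ∂a.law = a.cost := by
  have hw0 := wage_zero_eq_zero_of_index_le hρ h
  refine le_antisymm ?_ ?_
  · have h1 := (Strategy.admissible_sampleOnce (A := (Fin.cons a Fin.elim0 : Fin 1 → Project))
      0).agentPayoff_le_agentValue.trans (agentValue_le_zero_of_index_le hρ h)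
    rw [Strategy.agentPayoff_sampleOnce, EReal.sub_le_iff_le_add (by simp) (by simp)] at h1
    exact EReal.coe_ennreal_le_coe_ennreal_iff.1 (h1.trans_eq (zero_add _))
  · by_contra! hlt
    have hall : ∀ i : Fin 1, ∫⁻ y, ((w.wage y : ℝ≥0∞) - (0 : ℝ≥0))
        ∂((Fin.cons a Fin.elim0 : Fin 1 → Project) i).law
          < ((Fin.cons a Fin.elim0 : Fin 1 → Project) i).cost := by
      intro i
      rw [Subsingleton.elim i 0]
      simpa using hlt
    have hU : (Strategy.stopAtOnce 1).agentPayoff (Fin.cons a Fin.elim0 : Fin 1 → Project) w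
        = ((0 : ℝ≥0) : EReal) := by
      rw [Strategy.agentPayoff_stopAtOnce, hw0]
    have hle : payoffGuarantee a w ≤ 0 := by
      refine (payoffGuarantee_le Fin.elim0).trans
        (principalValue_le_of_isMax Strategy.admissible_stopAtOnce (fun σ _ => ?_) fun σ hσ => ?_)
      · rw [hU]
        exact σ.agentPayoff_le hw0.le fun i => (hall i).le
      · rw [hU] at hσ
        have hN : ∀ i, σ.drawCount (Fin.cons a Fin.elim0 : Fin 1 → Project) i = 0 := fun i =>
          σ.drawCount_eq_zero hw0.le (fun i => (hall i).le) hσ (hall i)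
        have hE := σ.lintegral_prize_le (Fin.cons a Fin.elim0 : Fin 1 → Project)
          (g := fun y => (y : ℝ≥0∞)) measurable_coe_nnreal_ennreal (x := 0) (by simp)
        simp only [hN, zero_mul, Finset.sum_const_zero, add_zero] at hE
        refine (σ.principalPayoff_le ENNReal.zero_ne_top hE).trans ?_
        refine EReal.sub_le_of_le_add ?_
        simp [EReal.coe_ennreal_nonneg]
    have := h.trans hle
    exact hρ0.not_ge (by exact_mod_cast this)

/-- If some prize pays the agent more than the debt contract, a free project with that prize
lets him ignore the known project. -/
lemma wage_le_sub_index (hρ : ∫⁻ y, ((y : ℝ≥0∞) - ρ) ∂a.law = a.cost) (hρ0 : 0 < ρ)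
    (hc : 0 < a.cost) (h : ((ρ : ℝ) : EReal) ≤ payoffGuarantee a w) (z : ℝ≥0) :
    w.wage z ≤ z - ρ := by
  by_contra! hz
  have hw0 := wage_zero_eq_zero_of_index_le hρ h
  have hwc := lintegral_wage_eq_cost hρ hρ0 h
  have hx : 0 < w.wage z := pos_of_gt hz
  have hwx : w.wage 0 ≤ w.wage z := hw0.le.trans hx.le
  -- Subtracting `w z > 0` strictly lowers the mean wage, since that mean is `c > 0`. Once `w z` is
  -- free, drawing from `a` is a strict loss.
  have hq : ∫⁻ y, ((w.wage y : ℝ≥0∞) - w.wage z) ∂a.law < a.cost := by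
    rw [← hwc]
    refine (lintegral_mono fun y => tsub_le_self).lt_of_ne fun heq => ?_
    have hae := ae_eq_of_ae_le_of_lintegral_le
      (μ := a.law) (f := fun y => (w.wage y : ℝ≥0∞) - w.wage z) (g := fun y => (w.wage y : ℝ≥0∞))
      (.of_forall fun y => tsub_le_self) (by rw [heq, hwc]; exact ENNReal.coe_ne_top)
      w.measurable_wage.coe_nnreal_ennreal.aemeasurable heq.ge
    have : ∫⁻ y, (w.wage y : ℝ≥0∞) ∂a.law = 0 := by
      rw [lintegral_eq_zero_iff w.measurable_wage.coe_nnreal_ennreal]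
      filter_upwards [hae] with y hy
      have hy : w.wage y - w.wage z = w.wage y := by exact_mod_cast hy
      by_contra hne
      exact (tsub_lt_self (pos_iff_ne_zero.2 fun h => hne (by simp [h])) hx).ne hy
    rw [hwc] at this
    exact hc.ne' (by exact_mod_cast this)
  let A : Fin 2 → Project := Fin.cons a fun _ : Fin 1 => freePrize z
  have hA0 : A 0 = a := rfl
  have hA1 : A 1 = freePrize z := rfl
  have hall : ∀ i, ∫⁻ y, ((w.wage y : ℝ≥0∞) - w.wage z) ∂(A i).law ≤ (A i).cost := by
    intro i
    fin_cases i
    · exact hq.le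
    · change ∫⁻ y, ((w.wage y : ℝ≥0∞) - w.wage z) ∂(Measure.dirac z) ≤ _
      rw [lintegral_dirac]
      simp
  have hU : (Strategy.sampleOnce 1).agentPayoff A w = (w.wage z : EReal) := by
    rw [Strategy.agentPayoff_sampleOnce, hA1]
    simp [freePrize]
  have hle : payoffGuarantee a w ≤ ((z - w.wage z : ℝ) : EReal) := by
    refine (payoffGuarantee_le fun _ : Fin 1 => freePrize z).trans
      (principalValue_le_of_isMax (Strategy.admissible_sampleOnce 1) (fun σ _ => ?_)
        fun σ hσ => ?_)
    · exact (σ.agentPayoff_le hwx hall).trans_eq hU.symm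
    · replace hσ := hU.symm.trans_le hσ
      have hN : σ.drawCount A 0 = 0 := σ.drawCount_eq_zero hwx hall hσ hq
      have hE : ∫⁻ ω, (σ.prize ω : ℝ≥0∞) ∂drawLaw A ≤ z := by
        refine (σ.lintegral_prize_le A (g := fun y => (y : ℝ≥0∞)) measurable_coe_nnreal_ennreal
          (x := z) (by simp)).trans_eq ?_
        rw [Fin.sum_univ_two, hN, hA1]
        simp [freePrize]
      have hW : (w.wage z : EReal)
          ≤ ((∫⁻ ω, (w.wage (σ.prize ω) : ℝ≥0∞) ∂drawLaw A : ℝ≥0∞) : EReal) := by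
        refine hσ.trans (EReal.sub_le_of_le_add ?_)
        exact le_add_of_nonneg_right (EReal.coe_ennreal_nonneg _)
      refine (σ.principalPayoff_le ENNReal.coe_ne_top hE).trans
        ((EReal.sub_le_sub le_rfl hW).trans_eq ?_)
      simp only [EReal.coe_nnreal_eq_coe_real, ← EReal.coe_sub]
  have h1 := h.trans hle
  rw [EReal.coe_le_coe_iff] at h1
  -- The truncated subtraction is harmless here: the guarantee gives `ρ ≤ z - w z`, hence `ρ ≤ z`.
  rw [tsub_lt_iff_right (by exact_mod_cast (show (ρ : ℝ) ≤ z by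
    linarith [(w.wage z).coe_nonneg]))] at hz
  have hz : (z : ℝ) < w.wage z + ρ := by exact_mod_cast hz
  linarith

/-- Pointwise domination together with equal finite integrals forces equality almost everywhere. -/
lemma wage_ae_eq_of_index_le (hρ : ∫⁻ y, ((y : ℝ≥0∞) - ρ) ∂a.law = a.cost) (hρ0 : 0 < ρ)
    (hc : 0 < a.cost) (h : ((ρ : ℝ) : EReal) ≤ payoffGuarantee a w) :
    ∀ᵐ y ∂a.law, w.wage y = y - ρ := by
  have hwc := lintegral_wage_eq_cost hρ hρ0 h
  have hae := ae_eq_of_ae_le_of_lintegral_le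
      (μ := a.law) (f := fun y => (w.wage y : ℝ≥0∞)) (g := fun y => (y : ℝ≥0∞) - ρ)
      (.of_forall fun y => by
        beta_reduce
        exact_mod_cast wage_le_sub_index hρ hρ0 hc h y)
      (by rw [hwc]; exact ENNReal.coe_ne_top)
      (measurable_coe_nnreal_ennreal.sub measurable_const).aemeasurable (hρ.trans hwc.symm).le
  filter_upwards [hae] with y hy
  exact_mod_cast hy

end Guarantee

/-! ### Prolonging a strategy until a prize of at least `ρ` is found. -/

/-- The highest prize in a list, and `0` if there is none. -/
def bestPrize (h : List ℝ≥0) : ℝ≥0 := h.foldr max 0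

lemma le_bestPrize {h : List ℝ≥0} {y : ℝ≥0} (hy : y ∈ h) : y ≤ bestPrize h := by
  induction h with
  | nil => simp at hy
  | cons z h ih =>
    rcases List.mem_cons.1 hy with rfl | hy
    · exact le_max_left _ _
    · exact (ih hy).trans (le_max_right _ _)

lemma bestPrize_mem (h : List ℝ≥0) : bestPrize h = 0 ∨ bestPrize h ∈ h := by
  induction h with
  | nil => exact .inl rfl
  | cons z h ih =>
    rcases max_choice z (bestPrize h) with hm | hm
    · exact .inr (List.mem_cons.2 (.inl hm))
    · change max z (bestPrize h) = 0 ∨ max z (bestPrize h) ∈ z :: h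
      rw [hm]
      exact ih.imp id fun h => List.mem_cons.2 (.inr h)

lemma measurable_bestPrize_ofFn (t : ℕ) :
    Measurable fun h : Fin t → ℝ≥0 => bestPrize (List.ofFn h) := by
  induction t with
  | zero => simp [bestPrize]
  | succ t ih =>
    have : (fun h : Fin (t + 1) → ℝ≥0 => bestPrize (List.ofFn h))
        = fun h => max (h 0) (bestPrize (List.ofFn fun i : Fin t => h i.succ)) := by
      funext h
      rw [List.ofFn_succ]
      rfl
    rw [this]
    exact (measurable_pi_apply 0).max
      (ih.comp (measurable_pi_lambda _ fun i => measurable_pi_apply _))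

lemma List.take_ofFn_of_le {α : Type*} {s t : ℕ} (hst : s ≤ t) (h : Fin t → α) :
    (List.ofFn h).take s = List.ofFn fun i : Fin s => h (Fin.castLE hst i) := by
  apply List.ext_getElem
  · simp [hst]
  · intro i h1 h2
    simp

namespace Strategy
variable {n : ℕ} (σ : Strategy (n + 1)) (ρ : ℝ≥0)

/-- The strategy `σ` has ceased searching along the list of prizes `h`. -/
def CeasedAlong {k : ℕ} (σ : Strategy k) (h : List ℝ≥0) : Prop :=
  ∃ p, p <+: h ∧ σ.next p = none

lemma measurableSet_ceasedAlong {k : ℕ} (σ : Strategy k) (t : ℕ) :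
    MeasurableSet {h : Fin t → ℝ≥0 | σ.CeasedAlong (List.ofFn h)} := by
  have : {h : Fin t → ℝ≥0 | σ.CeasedAlong (List.ofFn h)}
      = ⋃ s : ℕ, ⋃ hs : s ≤ t, (fun (h : Fin t → ℝ≥0) (i : Fin s) => h (Fin.castLE hs i)) ⁻¹'
          {h : Fin s → ℝ≥0 | σ.next (List.ofFn h) = none} := by
    ext h
    simp only [Set.mem_ofPred_eq, Set.mem_iUnion, Set.mem_preimage]
    constructor
    · rintro ⟨p, hp, hn⟩
      have hl : p.length ≤ t := by simpa using hp.length_le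
      refine ⟨p.length, hl, ?_⟩
      rw [← List.take_ofFn_of_le hl, ← List.prefix_iff_eq_take.1 hp, hn]
    · rintro ⟨s, hs, hn⟩
      exact ⟨(List.ofFn h).take s, List.take_prefix _ _, by rw [List.take_ofFn_of_le hs, hn]⟩
  rw [this]
  exact MeasurableSet.iUnion fun s => MeasurableSet.iUnion fun hs =>
    (measurable_pi_lambda _ fun i => measurable_pi_apply _) (σ.measurable_next s none)

open Classical in
/-- Follow `σ`; once it has ceased, keep sampling project `0` until a prize of at least `ρ` has been
drawn. Present the highest prize. -/
def prolong : Strategy (n + 1) where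
  next h := if σ.CeasedAlong h then (if ρ ≤ bestPrize h then none else some 0) else σ.next h
  present := bestPrize
  present_mem := bestPrize_mem
  measurable_next t d := by
    have hS := σ.measurableSet_ceasedAlong t
    have hB : MeasurableSet {h : Fin t → ℝ≥0 | ρ ≤ bestPrize (List.ofFn h)} :=
      measurableSet_le measurable_const (measurable_bestPrize_ofFn t)
    have : {h : Fin t → ℝ≥0 | (if σ.CeasedAlong (List.ofFn h) then
          (if ρ ≤ bestPrize (List.ofFn h) then none else some 0) else σ.next (List.ofFn h)) = d}
        = ({h : Fin t → ℝ≥0 | σ.CeasedAlong (List.ofFn h)} ∩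
            (({h : Fin t → ℝ≥0 | ρ ≤ bestPrize (List.ofFn h)} ∩ {_h | none = d}) ∪
              ({h : Fin t → ℝ≥0 | ρ ≤ bestPrize (List.ofFn h)}ᶜ ∩ {_h | some 0 = d}))) ∪
          ({h : Fin t → ℝ≥0 | σ.CeasedAlong (List.ofFn h)}ᶜ ∩
            {h : Fin t → ℝ≥0 | σ.next (List.ofFn h) = d}) := by
      ext h
      simp only [Set.mem_ofPred_eq, Set.mem_union, Set.mem_inter_iff, Set.mem_compl_iff]
      split_ifs <;> simp_all
    rw [this]
    exact (hS.inter ((hB.inter (.const _)).union (hB.compl.inter (.const _)))).union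
      (hS.compl.inter (σ.measurable_next t d))
  measurable_present := measurable_bestPrize_ofFn

variable {σ ρ} {ω : Draws (n + 1)} {t : ℕ}

lemma next_prolong_of_ceasedAlong {h : List ℝ≥0} (hc : σ.CeasedAlong h) :
    (σ.prolong ρ).next h = if ρ ≤ bestPrize h then none else some 0 := by
  simp [prolong, hc]

lemma next_prolong_of_not_ceasedAlong {h : List ℝ≥0} (hc : ¬ σ.CeasedAlong h) :
    (σ.prolong ρ).next h = σ.next h := by
  simp [prolong, hc]

/-- Draws are indexed by period, so both runs see the same prizes until `σ` ceases; then the history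
of `σ` freezes as a prefix. The clause on proper prefixes is needed because the prolonged strategy
must recognise from the list alone whether `σ` has ceased. -/
lemma history_prolong_invariant (σ : Strategy (n + 1)) (ρ : ℝ≥0) (ω : Draws (n + 1)) (t : ℕ) :
    σ.history ω t <+: (σ.prolong ρ).history ω t ∧
      (σ.next (σ.history ω t) = none ∨ ((σ.prolong ρ).history ω t = σ.history ω t ∧
        ∀ p, p <+: σ.history ω t → p ≠ σ.history ω t → σ.next p ≠ none)) := by
  induction t with
  | zero =>
    refine ⟨List.prefix_rfl, .inr ⟨rfl, fun p hp hne => ?_⟩⟩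
    simp only [history, List.prefix_nil] at hp hne
    exact absurd hp hne
  | succ t ih =>
    have hgrow : (σ.prolong ρ).history ω t <+: (σ.prolong ρ).history ω (t + 1) := by
      cases hd : (σ.prolong ρ).next ((σ.prolong ρ).history ω t) with
      | none => rw [history_succ_of_none _ hd]
      | some i => rw [history_succ_of_some _ hd]; exact List.prefix_append _ _
    cases hd : σ.next (σ.history ω t) with
    | none =>
      rw [history_succ_of_none _ hd]
      exact ⟨ih.1.trans hgrow, .inl hd⟩
    | some i =>
      obtain ⟨heq, hp⟩ := ih.2.resolve_left (by simp [hd])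
      have hnc : ¬ σ.CeasedAlong (σ.history ω t) := by
        rintro ⟨p, hpre, hn⟩
        by_cases h : p = σ.history ω t
        · simp [← h, hn] at hd
        · exact hp p hpre h hn
      have hd' : (σ.prolong ρ).next ((σ.prolong ρ).history ω t) = some i := by
        rw [heq, next_prolong_of_not_ceasedAlong hnc, hd]
      have heq' : (σ.prolong ρ).history ω (t + 1) = σ.history ω (t + 1) := by
        rw [history_succ_of_some _ hd', history_succ_of_some _ hd, heq]
      refine ⟨heq' ▸ List.prefix_rfl, .inr ⟨heq', fun p hpre hne hn => hnc ?_⟩⟩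
      rw [history_succ_of_some _ hd] at hpre hne
      exact ⟨p, (List.prefix_concat_iff.1 hpre).resolve_left hne, hn⟩

lemma next_prolong_of_some {i : Fin (n + 1)} (h : σ.next (σ.history ω t) = some i) :
    (σ.prolong ρ).next ((σ.prolong ρ).history ω t) = some i := by
  obtain ⟨heq, hp⟩ := (history_prolong_invariant σ ρ ω t).2.resolve_left (by simp [h])
  rw [heq, next_prolong_of_not_ceasedAlong, h]
  rintro ⟨p, hpre, hn⟩
  by_cases hne : p = σ.history ω t
  · simp [← hne, hn] at h
  · exact hp p hpre hne hn

lemma next_prolong_of_none (h : σ.next (σ.history ω t) = none) :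
    (σ.prolong ρ).next ((σ.prolong ρ).history ω t)
      = if ρ ≤ bestPrize ((σ.prolong ρ).history ω t) then none else some 0 :=
  next_prolong_of_ceasedAlong ⟨_, (history_prolong_invariant σ ρ ω t).1, h⟩

/-- The event that draw number `t` is made by `σ.prolong ρ`, but no longer by `σ`. -/
def extraDraw (σ : Strategy (n + 1)) (ρ : ℝ≥0) (t : ℕ) : Set (Draws (n + 1)) :=
  {ω | σ.next (σ.history ω t) = none} ∩
    {ω | (σ.prolong ρ).next ((σ.prolong ρ).history ω t) = some 0}

lemma measurableSet_extraDraw (σ : Strategy (n + 1)) (ρ : ℝ≥0) (t : ℕ) :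
    MeasurableSet (extraDraw σ ρ t) :=
  (σ.measurableSet_next_history t _).inter ((σ.prolong ρ).measurableSet_next_history t _)

lemma bestPrize_lt_of_mem_extraDraw (h : ω ∈ extraDraw σ ρ t) :
    bestPrize ((σ.prolong ρ).history ω t) < ρ := by
  by_contra! hle
  have h2 := h.2
  rw [Set.mem_ofPred_eq, next_prolong_of_none h.1, if_pos hle] at h2
  simp at h2

lemma next_prolong_of_notMem_extraDraw (h : σ.next (σ.history ω t) = none)
    (hn : ω ∉ extraDraw σ ρ t) :
    (σ.prolong ρ).next ((σ.prolong ρ).history ω t) = none := by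
  by_cases hle : ρ ≤ bestPrize ((σ.prolong ρ).history ω t)
  · rw [next_prolong_of_none h, if_pos hle]
  · exact absurd ⟨h, by rw [Set.mem_ofPred_eq, next_prolong_of_none h, if_neg hle]⟩ hn

lemma present_le_bestPrize (σ : Strategy (n + 1)) (ρ : ℝ≥0) (ω : Draws (n + 1)) (t : ℕ) :
    σ.present (σ.history ω t) ≤ bestPrize ((σ.prolong ρ).history ω t) := by
  rcases σ.present_mem (σ.history ω t) with h | h
  · rw [h]; exact zero_le
  · exact le_bestPrize ((history_prolong_invariant σ ρ ω t).1.subset h)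

/-- An extra draw is made only while the best prize is below `ρ`, when everything accumulated so far
has `φ`-value zero. Hence at most one term is nonzero, and the best prize dominates it. -/
lemma sum_extraDraw_invariant {φ : ℝ≥0 → ℝ≥0∞} (hφ : Monotone φ) (hφ0 : ∀ y < ρ, φ y = 0)
    (σ : Strategy (n + 1)) (ω : Draws (n + 1)) (t : ℕ) :
    (σ.next (σ.history ω t) ≠ none →
      ∑ s ∈ Finset.range t, (extraDraw σ ρ s).indicator 1 ω * φ (ω (s, 0)) = 0) ∧
    (σ.next (σ.history ω t) = none → φ (σ.present (σ.history ω t)) +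
        ∑ s ∈ Finset.range t, (extraDraw σ ρ s).indicator 1 ω * φ (ω (s, 0))
      ≤ φ (bestPrize ((σ.prolong ρ).history ω t))) := by
  induction t with
  | zero => exact ⟨fun _ => by simp, fun _ => by simpa using hφ (present_le_bestPrize σ ρ ω 0)⟩
  | succ t ih =>
    rw [Finset.sum_range_succ]
    by_cases hd : σ.next (σ.history ω t) = none
    · refine ⟨fun h => absurd (σ.next_history_eq_none_of_le hd t.le_succ) h, fun _ => ?_⟩
      rw [σ.history_succ_of_none hd]
      by_cases hG : ω ∈ extraDraw σ ρ t
      · have h0 := (ih.2 hd).trans_eq (hφ0 _ (bestPrize_lt_of_mem_extraDraw hG))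
        rw [← add_assoc, le_antisymm h0 zero_le, zero_add, Set.indicator_of_mem hG, Pi.one_apply,
          one_mul, (σ.prolong ρ).history_succ_of_some hG.2]
        exact hφ (le_bestPrize (by simp))
      · rw [Set.indicator_of_notMem hG, zero_mul, add_zero,
          history_succ_of_none _ (next_prolong_of_notMem_extraDraw hd hG)]
        exact ih.2 hd
    · rw [ih.1 hd, Set.indicator_of_notMem (fun hG => hd hG.1), zero_mul, add_zero]
      exact ⟨fun _ => rfl, fun _ => by simpa using hφ (present_le_bestPrize σ ρ ω (t + 1))⟩

lemma lintegral_extraDraw (A : Fin (n + 1) → Project) {φ : ℝ≥0 → ℝ≥0∞} (hφ : Measurable φ)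
    (σ : Strategy (n + 1)) (ρ : ℝ≥0) :
    ∫⁻ ω, ∑' t, (extraDraw σ ρ t).indicator 1 ω * φ (ω (t, 0)) ∂drawLaw A
      = (∑' t, drawLaw A (extraDraw σ ρ t)) * ∫⁻ y, φ y ∂(A 0).law := by
  have hm : ∀ t, Measurable fun ω : Draws (n + 1) =>
      (extraDraw σ ρ t).indicator 1 ω * φ (ω (t, 0)) := fun t =>
    (measurable_one.indicator (measurableSet_extraDraw σ ρ t)).mul
      (hφ.comp (measurable_pi_apply (t, 0)))
  rw [lintegral_tsum fun t => (hm t).aemeasurable, ← ENNReal.tsum_mul_right]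
  refine tsum_congr fun t => lintegral_predictable_mul A t 0 (measurableSet_extraDraw σ ρ t)
    (fun ω ω' h => ?_) hφ
  simp only [extraDraw, Set.mem_inter_iff, Set.mem_ofPred_eq, history_congr _ h]

/-! ### Termination and cost of the prolonged strategy. -/

section Law
variable {A : Fin (n + 1) → Project}

/-- Take `φ` to be the indicator of `[ρ, ∞)`: at most one extra draw succeeds, so the expected
number of extra draws times the success probability is at most one. -/
lemma tsum_extraDraw_ne_top (h : (A 0).law (Set.Ici ρ) ≠ 0) :
    ∑' t, drawLaw A (extraDraw σ ρ t) ≠ ∞ := by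
  let φ : ℝ≥0 → ℝ≥0∞ := (Set.Ici ρ).indicator 1
  have hφ1 : ∀ y, φ y ≤ 1 := fun y => Set.indicator_le_self' (by simp) y
  have hφ : Monotone φ := fun x y hxy => by
    by_cases hx : x ∈ Set.Ici ρ
    · have hy : y ∈ Set.Ici ρ := (Set.mem_Ici.1 hx).trans hxy
      simp [φ, Set.indicator_of_mem hx, Set.indicator_of_mem hy]
    · simp only [φ, Set.indicator_of_notMem hx]
      exact zero_le
  have hφ0 : ∀ y < ρ, φ y = 0 := fun y hy => Set.indicator_of_notMem (by simpa using hy) _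
  have h1 := lintegral_extraDraw A (φ := φ) (measurable_one.indicator measurableSet_Ici) σ ρ
  rw [lintegral_indicator_one measurableSet_Ici] at h1
  have h2 : ∫⁻ ω, ∑' t, (extraDraw σ ρ t).indicator 1 ω * φ (ω (t, 0)) ∂drawLaw A ≤ 1 := by
    refine (lintegral_mono fun ω => ENNReal.tsum_le_of_sum_range_le (c := 1) fun t => ?_).trans_eq
      (by simp)
    have := sum_extraDraw_invariant hφ hφ0 σ ω t
    by_cases hd : σ.next (σ.history ω t) = none
    · exact le_add_self.trans ((this.2 hd).trans (hφ1 _))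
    · rw [this.1 hd]; exact zero_le
  rw [h1] at h2
  intro htop
  rw [htop, ENNReal.top_mul h] at h2
  simp at h2

/-- By Borel–Cantelli there are almost surely finitely many extra draws; a period without one after
`σ` has ceased is a stop. -/
lemma admissible_prolong (hσ : σ.Admissible A) (h : (A 0).law (Set.Ici ρ) ≠ 0) :
    (σ.prolong ρ).Admissible A := by
  filter_upwards [hσ, ae_eventually_notMem (tsum_extraDraw_ne_top (σ := σ) h)] with ω hs hω
  obtain ⟨s, hs⟩ := hs
  obtain ⟨t, ht, hst⟩ := (hω.and (Filter.eventually_ge_atTop s)).exists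
  exact ⟨t, next_prolong_of_notMem_extraDraw (σ.next_history_eq_none_of_le hs hst) ht⟩

lemma le_prize_prolong (hs : σ.Stops ω) (hs' : (σ.prolong ρ).Stops ω) :
    ρ ≤ (σ.prolong ρ).prize ω := by
  obtain ⟨s, hs⟩ := hs
  obtain ⟨t, ht⟩ := hs'
  have h1 := σ.next_history_eq_none_of_le hs (le_max_left s t)
  have h2 := (σ.prolong ρ).next_history_eq_none_of_le ht (le_max_right s t)
  rw [prize_eq _ h2]
  rw [next_prolong_of_none h1] at h2
  by_contra hle
  rw [if_neg (by exact hle)] at h2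
  simp at h2

lemma add_tsum_extraDraw_le {φ : ℝ≥0 → ℝ≥0∞} (hφ : Monotone φ) (hφ0 : ∀ y < ρ, φ y = 0)
    (hs : σ.Stops ω) (hs' : (σ.prolong ρ).Stops ω) :
    φ (σ.prize ω) + ∑' t, (extraDraw σ ρ t).indicator 1 ω * φ (ω (t, 0))
      ≤ φ ((σ.prolong ρ).prize ω) := by
  obtain ⟨s, hs⟩ := hs
  obtain ⟨t, ht⟩ := hs'
  rw [ENNReal.tsum_eq_iSup_nat, ENNReal.add_iSup]
  refine iSup_le fun m => ?_
  have h1 := σ.next_history_eq_none_of_le hs ((le_max_left s t).trans (le_max_left _ m))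
  have h2 := (σ.prolong ρ).next_history_eq_none_of_le ht
    ((le_max_right s t).trans (le_max_left _ m))
  rw [prize_eq _ h2, prize_eq _ h1]
  refine le_trans ?_ ((sum_extraDraw_invariant hφ hφ0 σ ω _).2 h1)
  gcongr
  exact le_max_right _ m

lemma totalCost_prolong (σ : Strategy (n + 1)) (ρ : ℝ≥0) (ω : Draws (n + 1)) :
    (σ.prolong ρ).totalCost A ω
      = σ.totalCost A ω + ∑' t, (extraDraw σ ρ t).indicator 1 ω * ((A 0).cost : ℝ≥0∞) := by
  rw [totalCost, totalCost, ← ENNReal.tsum_add]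
  refine tsum_congr fun t => ?_
  cases hd : σ.next (σ.history ω t) with
  | some i =>
    rw [Set.indicator_of_notMem (fun hG => Option.some_ne_none i (hd.symm.trans hG.1))]
    simp [periodCost, hd, next_prolong_of_some (ρ := ρ) hd]
  | none =>
    by_cases hG : ω ∈ extraDraw σ ρ t
    · rw [Set.indicator_of_mem hG]
      have := hG.2
      rw [Set.mem_ofPred_eq] at this
      simp [periodCost, hd, this]
    · rw [Set.indicator_of_notMem hG]
      simp [periodCost, hd, next_prolong_of_notMem_extraDraw hd hG]

lemma lintegral_totalCost_prolong (σ : Strategy (n + 1)) (ρ : ℝ≥0) :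
    ∫⁻ ω, (σ.prolong ρ).totalCost A ω ∂drawLaw A
      = ∫⁻ ω, σ.totalCost A ω ∂drawLaw A
        + (∑' t, drawLaw A (extraDraw σ ρ t)) * (A 0).cost := by
  have h := lintegral_extraDraw A (φ := fun _ => ((A 0).cost : ℝ≥0∞)) measurable_const σ ρ
  rw [lintegral_const, measure_univ, mul_one] at h
  simp_rw [totalCost_prolong]
  rw [lintegral_add_right, h]
  exact Measurable.tsum fun t =>
    (measurable_one.indicator (measurableSet_extraDraw σ ρ t)).mul_const _

end Law

end Strategy

/-! ### The debt contract guarantees the index. -/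

section Debt
variable {n : ℕ} {A : Fin (n + 1) → Project} {ρ : ℝ≥0} {σ : Strategy (n + 1)}

lemma wage_debtContract (ρ y : ℝ≥0) : (debtContract ρ).wage y = y - ρ := rfl

lemma measurable_coe_sub (ρ : ℝ≥0) : Measurable fun y : ℝ≥0 => (y : ℝ≥0∞) - ρ :=
  measurable_coe_nnreal_ennreal.sub measurable_const

lemma law_Ici_ne_zero {a : Project} (hρ : ∫⁻ y, ((y : ℝ≥0∞) - ρ) ∂a.law = a.cost)
    (hc : 0 < a.cost) : a.law (Set.Ici ρ) ≠ 0 := by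
  intro h0
  have : ∫⁻ y, ((y : ℝ≥0∞) - ρ) ∂a.law = 0 := by
    rw [lintegral_eq_zero_iff (measurable_coe_sub ρ)]
    filter_upwards [measure_eq_zero_iff_ae_notMem.1 h0] with y hy
    exact tsub_eq_zero_of_le (by exact_mod_cast (not_le.1 hy).le)
  rw [hρ] at this
  exact hc.ne' (by exact_mod_cast this)

/-- Under the debt contract, sampling the known project further costs the agent nothing net. -/
lemma agentPayoff_le_prolong (hρ : ∫⁻ y, ((y : ℝ≥0∞) - ρ) ∂(A 0).law = (A 0).cost)
    (hc : 0 < (A 0).cost) (hσ : σ.Admissible A) :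
    σ.agentPayoff A (debtContract ρ) ≤ (σ.prolong ρ).agentPayoff A (debtContract ρ) := by
  have hI := law_Ici_ne_zero hρ hc
  have hQ : (∑' t, drawLaw A (Strategy.extraDraw σ ρ t)) * (A 0).cost ≠ ∞ :=
    ENNReal.mul_ne_top (Strategy.tsum_extraDraw_ne_top hI) ENNReal.coe_ne_top
  have hφ : Monotone fun y : ℝ≥0 => (y : ℝ≥0∞) - ρ := fun x y hxy =>
    tsub_le_tsub_right (by exact_mod_cast hxy) _
  have hφm := measurable_coe_sub ρ
  have hφp : Measurable fun ω => (σ.prize ω : ℝ≥0∞) - ρ := hφm.comp σ.measurable_prize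
  have hφ0 : ∀ y < ρ, (y : ℝ≥0∞) - ρ = 0 := fun y hy =>
    tsub_eq_zero_of_le (by exact_mod_cast hy.le)
  -- Taking `φ y = [y - ρ]⁺`, the wage itself, each extra draw adds its mean excess, which by `hρ`
  -- is its cost.
  have hW : ∫⁻ ω, ((σ.prize ω : ℝ≥0∞) - ρ) ∂drawLaw A
        + (∑' t, drawLaw A (Strategy.extraDraw σ ρ t)) * (A 0).cost
      ≤ ∫⁻ ω, (((σ.prolong ρ).prize ω : ℝ≥0∞) - ρ) ∂drawLaw A := by
    have h := Strategy.lintegral_extraDraw A hφm σ ρ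
    rw [hρ] at h
    rw [← h, ← lintegral_add_left hφp]
    refine lintegral_mono_ae ?_
    filter_upwards [hσ, Strategy.admissible_prolong hσ hI] with ω hs hs'
    exact Strategy.add_tsum_extraDraw_le hφ hφ0 hs hs'
  unfold Strategy.agentPayoff
  simp only [wage_debtContract, ENNReal.coe_sub]
  rw [Strategy.lintegral_totalCost_prolong]
  generalize (∑' t, drawLaw A (Strategy.extraDraw σ ρ t)) * ((A 0).cost : ℝ≥0∞) = q at *
  have hW' := EReal.coe_ennreal_le_coe_ennreal_iff.2 hW
  rw [EReal.coe_ennreal_add] at hW'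
  generalize ∫⁻ ω, σ.totalCost A ω ∂drawLaw A = C at *
  by_cases hC : C = ∞
  · simp [hC, EReal.sub_top]
  have hCq : C + q ≠ ∞ := ENNReal.add_ne_top.2 ⟨hC, hQ⟩
  rw [EReal.le_sub_iff_add_le (by simp) (.inl (mt EReal.coe_ennreal_eq_top_iff.1 hCq))]
  refine le_trans ?_ hW'
  rw [EReal.coe_ennreal_add, ← add_assoc]
  exact add_le_add_left (EReal.add_le_of_le_sub le_rfl) _

lemma principalPayoff_prolong (hρ : ∫⁻ y, ((y : ℝ≥0∞) - ρ) ∂(A 0).law = (A 0).cost)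
    (hc : 0 < (A 0).cost) (hσ : σ.Admissible A) :
    (σ.prolong ρ).principalPayoff A (debtContract ρ) = ((ρ : ℝ) : EReal) := by
  have hae : ∀ᵐ ω ∂drawLaw A, ((σ.prolong ρ).prize ω : ℝ)
      - ((debtContract ρ).wage ((σ.prolong ρ).prize ω) : ℝ) = ρ := by
    filter_upwards [hσ, Strategy.admissible_prolong hσ (law_Ici_ne_zero hρ hc)] with ω hs hs'
    rw [wage_debtContract, NNReal.coe_sub (Strategy.le_prize_prolong hs hs')]
    ring
  have h1 : ∫⁻ ω, ENNReal.ofReal (((σ.prolong ρ).prize ω : ℝ)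
      - ((debtContract ρ).wage ((σ.prolong ρ).prize ω) : ℝ)) ∂drawLaw A = ρ := by
    rw [lintegral_congr_ae (g := fun _ => (ρ : ℝ≥0∞))
      (hae.mono fun ω h => by simp only [h, ENNReal.ofReal_coe_nnreal])]
    simp
  have h2 : ∫⁻ ω, ENNReal.ofReal (((debtContract ρ).wage ((σ.prolong ρ).prize ω) : ℝ)
      - ((σ.prolong ρ).prize ω : ℝ)) ∂drawLaw A = 0 := by
    rw [lintegral_congr_ae (g := fun _ => 0) (hae.mono fun ω h => by
      have := ρ.coe_nonneg
      exact ENNReal.ofReal_of_nonpos (by linarith))]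
    simp
  rw [Strategy.principalPayoff, h1, h2, EReal.coe_ennreal_zero, sub_zero]
  rfl

/-- Prolonging preserves optimality, and likewise any strict lower bound on the agent's payoff, so
both cases of the definition contain a strategy worth exactly `ρ`. -/
lemma index_le_principalValue (hρ : ∫⁻ y, ((y : ℝ≥0∞) - ρ) ∂(A 0).law = (A 0).cost)
    (hc : 0 < (A 0).cost) : ((ρ : ℝ) : EReal) ≤ principalValue (debtContract ρ) A := by
  have hI := law_Ici_ne_zero hρ hc
  unfold principalValue
  split_ifs with hne
  · obtain ⟨σ, hσ, hmax⟩ := hne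
    refine le_iSup₂_of_le (σ.prolong ρ) ⟨Strategy.admissible_prolong hσ hI, fun τ hτ => ?_⟩
      (principalPayoff_prolong hρ hc hσ).ge
    exact (hmax τ hτ).trans (agentPayoff_le_prolong hρ hc hσ)
  · refine le_iInf₂ fun v hv => ?_
    obtain ⟨σ, hv⟩ := lt_iSup_iff.1 hv
    obtain ⟨hσ, hv⟩ := lt_iSup_iff.1 hv
    exact le_iSup₂_of_le (σ.prolong ρ) ⟨Strategy.admissible_prolong hσ hI,
      hv.trans_le (agentPayoff_le_prolong hρ hc hσ)⟩ (principalPayoff_prolong hρ hc hσ).ge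

lemma index_le_payoffGuarantee {a : Project} (hρ : ∫⁻ y, ((y : ℝ≥0∞) - ρ) ∂a.law = a.cost)
    (hc : 0 < a.cost) : ((ρ : ℝ) : EReal) ≤ payoffGuarantee a (debtContract ρ) :=
  le_iInf fun n => le_iInf fun others =>
    index_le_principalValue (A := (Fin.cons a others : Fin (n + 1) → Project)) hρ hc

end Debt

/-! ### The index as a positive number, and the conclusion. -/

lemma exists_nnreal_index {a : Project} {r : ℝ} (hsurplus : (a.cost : ℝ) < ∫ y, (y : ℝ) ∂a.law)
    (hr : IsIndex a r) :
    ∃ ρ : ℝ≥0, 0 < ρ ∧ r = ρ ∧ ∫⁻ y, ((y : ℝ≥0∞) - ρ) ∂a.law = a.cost := by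
  have hint : Integrable (fun y : ℝ≥0 => (y : ℝ)) a.law := by
    refine ⟨measurable_coe_nnreal_real.aestronglyMeasurable, ?_⟩
    rw [hasFiniteIntegral_iff_ofReal (.of_forall fun y => y.coe_nonneg)]
    simpa using a.mean_ne_top.lt_top
  have hint2 : Integrable (fun y : ℝ≥0 => max ((y : ℝ) - r) 0) a.law :=
    (hint.sub (integrable_const r)).pos_part
  have hr' : ∫ y, max ((y : ℝ) - r) 0 ∂a.law = (a.cost : ℝ) := hr.1
  have hr0 : 0 < r := by
    -- If `r ≤ 0`, then `[y - r]⁺ ≥ y`, so the cost would be at least the mean prize.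
    by_contra! hle
    refine hsurplus.not_ge (hr' ▸ integral_mono hint hint2 fun y => ?_)
    exact le_max_of_le_left (by linarith)
  lift r to ℝ≥0 using hr0.le
  refine ⟨r, by exact_mod_cast hr0, rfl, ?_⟩
  have h := ofReal_integral_eq_lintegral_ofReal hint2 (.of_forall fun y => le_max_right _ _)
  rw [hr', ENNReal.ofReal_coe_nnreal] at h
  rw [h]
  refine lintegral_congr fun y => ?_
  rw [ENNReal.ofReal_max, ENNReal.ofReal_zero, ENNReal.ofReal_sub _ r.coe_nonneg]
  simp

end

theorem proposition2 (a₀ : Project) (r₀ : ℝ)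
    (hcost : 0 < a₀.cost)
    (hsurplus : (a₀.cost : ℝ) < ∫ y, (y : ℝ) ∂a₀.law)
    (hfull : a₀.law.support = Set.univ)
    (hr₀ : IsIndex a₀ r₀) :
    IsRobustlyOptimal a₀ (debtContract r₀) ∧
      ∀ w : Contract, IsRobustlyOptimal a₀ w →
        (∀ᵐ y ∂a₀.law, (w.wage y : ℝ) = max ((y : ℝ) - r₀) 0) ∧
        (lebesgueNN ≪ a₀.law →
          ∀ᵐ y ∂lebesgueNN, (w.wage y : ℝ) = max ((y : ℝ) - r₀) 0) := by
  obtain ⟨ρ, hρ0, rfl, hρ⟩ := exists_nnreal_index hsurplus hr₀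
  have hdebt := index_le_payoffGuarantee hρ hcost
  have hsup : ⨆ w : Contract, payoffGuarantee a₀ w = ((ρ : ℝ) : EReal) :=
    le_antisymm (iSup_le fun w => payoffGuarantee_le_index hρ) (le_iSup_of_le _ hdebt)
  refine ⟨(hsup.trans_le hdebt).antisymm' (le_iSup _ _), fun w hw => ?_⟩
  have hae : ∀ᵐ y ∂a₀.law, (w.wage y : ℝ) = max ((y : ℝ) - ρ) 0 := by
    filter_upwards [wage_ae_eq_of_index_le hρ hρ0 hcost (hsup.symm.trans hw.symm).le] with y hy
    rw [hy, NNReal.coe_sub_def]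
  exact ⟨hae, fun hac => hac.ae_le hae⟩
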